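/- Let $d\ge 1$ and let $\Omega\subseteq\mathbb R^d$ be bounded and convex. For $\nu>0$ and a diagonal matrix $\Theta=\operatorname{diag}(\theta_1,\dots,\theta_d)$ of lengthscales $\theta_i>0$, the Matérn kernel is $\Phi_{\nu,\Theta}(x,x')=\phi_\nu(\|\Theta^{-1}(x-x')\|_2)$, where $$\phi_\nu(r)=\frac{2^{1-\nu}}{\Gamma(\nu)}\,(r\sqrt{2\nu})^{\nu}B_\nu(r\sqrt{2\nu})\quad(r>0),\qquad \phi_\nu(0)=1,$$ and $B_\nu$ is the modified Bessel function of the second kind. For a kernel $\Phi$, $\mathcal N_\Phi(\Omega)$ denotes its native space (reproducing kernel Hilbert space) on $\Omega$, with norm $\|\cdot\|_{\mathcal N_\Phi(\Omega)}$. Let $C_1,C_2,C_3,C_4,\nu_{\min},\nu_{\max}>0$. Then there is a constant $c_0>0$, depending only on $d$, $\Omega$, $C_1,C_2,C_3,C_4$, $\nu_{\min}$ and $\nu_{\max}$, such that the following holds. Let $L\ge 1$, and for $l=1,\dots,L$ let $\nu_l>0$ and $\Theta_l$ be Matérn parameters as above with $$C_1\le\|\Theta_l^{-1}\|_2\le C_2,\qquad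 C_3\le\|\Theta_l\|_2\le C_4,\qquad \nu_{\min}\le\nu_l\le\nu_{\max},$$ where $\|\cdot\|_2$ is the spectral norm, and put $\Phi_l=\Phi_{\nu_l,\Theta_l}$. Let $\mathcal X_L\subseteq\mathcal X_{L-1}\subseteq\cdots\subseteq\mathcal X_1\subseteq\Omega$ be finite nonempty designs, and let $f_0\equiv 0$ and $f_1,\dots,f_L:\Omega\to\mathbb R$ be such that $f_l-f_{l-1}\in\mathcal N_{\Phi_l}(\Omega)$ for $l=1,\dots,L$. Define the multi-level RKHS interpolator $$\hat f_L(x)=\sum_{l=1}^L\mathcal P_l(x),\qquad \mathcal P_l(x)=\sum_{u\in\mathcal X_l}\alpha^l_u\,\Phi_l(x,u),\qquad (\alpha^l_u)_{u\in\mathcal X_l}=\boldsymbol\Phi_l^{-1}\,(f_l-f_{l-1})|_{\mathcal X_l},$$ with $\boldsymbol\Phi_l=[\Phi_l(u,v)]_{u,v\in\mathcal X_l}$. Then for every $x\in\Omega$ $$|f_L(x)-\hat f_L(x)|\le c_0\sum_{l=1}^L\|\Theta_l^{-1}\|_2^{\nu_l}\,h_{\mathcal X_l}^{\nu_l}\,\|f_l-f_{l-1}\|_{\mathcal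 N_{\Phi_l}(\Omega)},$$ where $h_{\mathcal X_l}=\sup_{x\in\Omega}\min_{u\in\mathcal X_l}\|x-u\|_2$ is the fill distance of $\mathcal X_l$. -/

import Mathlib

open Real Set MeasureTheory

noncomputable section

/-- The modified Bessel function of the second kind of real order `ν`, at `z > 0`, through its
classical integral representation `K_ν(z) = ∫_0^∞ exp(-z cosh t) cosh(ν t) dt`. -/
def besselK (ν z : ℝ) : ℝ :=
  ∫ t in Ioi (0 : ℝ), Real.exp (-z * Real.cosh t) * Real.cosh (ν * t)

/-- The radial Matérn function
`φ_ν(r) = 2^(1-ν) / Γ(ν) * (r √(2ν))^ν * K_ν(r √(2ν))` for `r > 0`.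
At `r = 0`, where the formula is read as its limit, the value is `1`. -/
def maternRadial (ν r : ℝ) : ℝ :=
  if r = 0 then 1
  else (2 : ℝ) ^ (1 - ν) / Real.Gamma ν * (r * √(2 * ν)) ^ ν * besselK ν (r * √(2 * ν))

/-- Hyperparameters of a Matérn kernel on `ℝ^d`: a smoothness parameter `ν > 0` and `d` positive
lengthscales. -/
structure MaternParams (d : ℕ) where
  /-- the smoothness parameter -/
  ν : ℝ
  /-- the lengthscales -/
  θ : Fin d → ℝ
  ν_pos : 0 < ν
  θ_pos : ∀ i, 0 < θ i

/-- The diagonal matrix `Θ` of lengthscales. -/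
def MaternParams.Θ {d : ℕ} (p : MaternParams d) : Matrix (Fin d) (Fin d) ℝ :=
  Matrix.diagonal p.θ

/-- The spectral norm `‖A‖₂` of a square matrix: its operator norm for the Euclidean norm. -/
def specNorm {d : ℕ} (A : Matrix (Fin d) (Fin d) ℝ) : ℝ :=
  ‖Matrix.toEuclideanCLM (n := Fin d) (𝕜 := ℝ) A‖

/-- The Matérn kernel `Φ(x, y) = φ_ν(‖Θ⁻¹ (x - y)‖₂)`. -/
def maternKernel {d : ℕ} (p : MaternParams d) (x y : EuclideanSpace ℝ (Fin d)) : ℝ :=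
  maternRadial p.ν ‖Matrix.toEuclideanCLM (n := Fin d) (𝕜 := ℝ) p.Θ⁻¹ (x - y)‖

/-- The integrand of the Gaussian scale mixture is integrable. -/
theorem integrableOn_maternMixture {ν : ℝ} (hν : 0 < ν) {a : ℝ} (ha : 0 ≤ a) :
    IntegrableOn (fun s : ℝ => (Real.exp (-s) * s ^ (ν - 1)) * Real.exp (-(a / s))) (Ioi 0) := by
  refine Integrable.mono' (Real.GammaIntegral_convergent hν) ?_ ?_
  · exact (Measurable.aestronglyMeasurable (by fun_prop))
  · filter_upwards [ae_restrict_mem measurableSet_Ioi] with s hs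
    have hs' : (0 : ℝ) < s := hs
    have h1 : 0 ≤ Real.exp (-s) * s ^ (ν - 1) := by positivity
    rw [Real.norm_of_nonneg (by positivity)]
    have h2 : Real.exp (-(a / s)) ≤ 1 := Real.exp_le_one_iff.2 (by
      have : 0 ≤ a / s := by positivity
      linarith)
    exact mul_le_of_le_one_right h1 h2

/-- The second classical integral representation of `K_ν`. -/
theorem besselK_eq_integral {ν z : ℝ} (hν : 0 < ν) (hz : 0 < z) :
    besselK ν z = 1 / 2 * (z / 2) ^ (-ν) *
      ∫ s in Ioi (0 : ℝ), (Real.exp (-s) * s ^ (ν - 1)) * Real.exp (-(z ^ 2 / 4 / s)) := by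
  have hz2 : 0 < z / 2 := by positivity
  set g : ℝ → ℝ := fun s => (Real.exp (-s) * s ^ (ν - 1)) * Real.exp (-(z ^ 2 / 4 / s)) with hg
  set F : ℝ → ℝ := fun u => Real.exp (-z * Real.cosh u) * Real.exp (ν * u) with hF
  have himg : (fun u : ℝ => z / 2 * Real.exp u) '' univ = Ioi 0 := by
    ext s
    simp only [image_univ, mem_range, mem_Ioi]
    constructor
    · rintro ⟨u, rfl⟩; positivity
    · intro hs
      refine ⟨Real.log (s / (z / 2)), ?_⟩
      rw [Real.exp_log (by positivity)]
      field_simp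
  have hder : ∀ u ∈ (univ : Set ℝ),
      HasDerivWithinAt (fun u : ℝ => z / 2 * Real.exp u) (z / 2 * Real.exp u) univ u :=
    fun u _ => ((Real.hasDerivAt_exp u).const_mul (z / 2)).hasDerivWithinAt
  have hinj : InjOn (fun u : ℝ => z / 2 * Real.exp u) univ := by
    intro a _ b _ hab
    exact Real.exp_injective (mul_left_cancel₀ hz2.ne' hab)
  have hpt : ∀ u : ℝ, |z / 2 * Real.exp u| • g (z / 2 * Real.exp u) = (z / 2) ^ ν * F u := by
    intro u
    have hpos : 0 < z / 2 * Real.exp u := by positivity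
    rw [abs_of_pos hpos, smul_eq_mul, hg, hF]
    simp only
    have e1 : z / 2 * Real.exp u * (z / 2 * Real.exp u) ^ (ν - 1) = (z / 2 * Real.exp u) ^ ν := by
      rw [Real.rpow_sub_one hpos.ne']
      field_simp
    have e2 : (z / 2 * Real.exp u) ^ ν = (z / 2) ^ ν * Real.exp (ν * u) := by
      rw [Real.mul_rpow hz2.le (Real.exp_pos u).le, ← Real.exp_mul, mul_comm u ν]
    have e3 : Real.exp (-(z / 2 * Real.exp u)) * Real.exp (-(z ^ 2 / 4 / (z / 2 * Real.exp u)))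
        = Real.exp (-z * Real.cosh u) := by
      rw [← Real.exp_add, Real.cosh_eq, Real.exp_neg u]
      congr 1
      field_simp
      ring
    calc _ = (z / 2 * Real.exp u * (z / 2 * Real.exp u) ^ (ν - 1)) *
          (Real.exp (-(z / 2 * Real.exp u)) *
            Real.exp (-(z ^ 2 / 4 / (z / 2 * Real.exp u)))) := by ring
      _ = _ := by rw [e1, e2, e3]; ring
  have hgint : IntegrableOn g (Ioi 0) := integrableOn_maternMixture hν (by positivity)
  have hFint : Integrable F := by
    rw [← himg, integrableOn_image_iff_integrableOn_abs_deriv_smul MeasurableSet.univ hder hinj,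
      integrableOn_univ] at hgint
    simp only [hpt] at hgint
    exact (integrable_const_mul_iff (IsUnit.mk0 _ (Real.rpow_pos_of_pos hz2 ν).ne') F).1 hgint
  have hmain : ∫ s in Ioi (0 : ℝ), g s = (z / 2) ^ ν * ∫ u, F u := by
    rw [← himg, integral_image_eq_integral_abs_deriv_smul MeasurableSet.univ hder hinj,
      Measure.restrict_univ]
    simp only [hpt]
    rw [integral_const_mul]
  have hF2 : ∫ u, F u = 2 * besselK ν z := by
    have h1 : ∫ u, F (-u) = ∫ u, F u := integral_neg_eq_self F volume
    have h2 : ∫ u, F u = ∫ u, (F u + F (-u)) / 2 := by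
      rw [integral_div, integral_add hFint hFint.comp_neg, h1]
      ring
    have h3 : ∀ u, (F u + F (-u)) / 2 =
        (fun t => Real.exp (-z * Real.cosh t) * Real.cosh (ν * t)) |u| := by
      intro u
      have e : Real.cosh (ν * |u|) = Real.cosh (ν * u) := by
        rw [← Real.cosh_abs (ν * u), abs_mul, abs_of_pos hν]
      simp only [hF, Real.cosh_abs, e, Real.cosh_neg, Real.cosh_eq (ν * u), mul_neg]
      ring
    rw [h2]
    simp only [h3]
    rw [integral_comp_abs (f := fun t => Real.exp (-z * Real.cosh t) * Real.cosh (ν * t))]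
    rfl
  rw [hmain, hF2, Real.rpow_neg hz2.le]
  have := (Real.rpow_pos_of_pos hz2 ν).ne'
  field_simp

/-- The Matérn function is a Gaussian scale mixture. -/
theorem maternRadial_eq_integral {ν r : ℝ} (hν : 0 < ν) (hr : 0 ≤ r) :
    maternRadial ν r = 1 / Real.Gamma ν *
      ∫ s in Ioi (0 : ℝ), (Real.exp (-s) * s ^ (ν - 1)) * Real.exp (-(ν * r ^ 2 / 2 / s)) := by
  have hΓ := (Real.Gamma_pos_of_pos hν).ne'
  rcases hr.eq_or_lt with rfl | hr
  · have := Real.Gamma_eq_integral hν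
    simp only [maternRadial, if_true, ne_eq, OfNat.ofNat_ne_zero, not_false_eq_true, zero_pow,
      mul_zero, zero_div, neg_zero, Real.exp_zero, mul_one]
    rw [← this]
    field_simp
  · have hz : 0 < r * √(2 * ν) := by positivity
    rw [maternRadial, if_neg hr.ne', besselK_eq_integral hν hz]
    have e : (r * √(2 * ν)) ^ 2 / 4 = ν * r ^ 2 / 2 := by
      rw [mul_pow, Real.sq_sqrt (by positivity)]; ring
    rw [e, Real.rpow_neg (by positivity), Real.div_rpow hz.le (by norm_num),
      Real.rpow_sub (by norm_num), Real.rpow_one]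
    have h1 := (Real.rpow_pos_of_pos hz ν).ne'
    have h2 := (Real.rpow_pos_of_pos (show (0 : ℝ) < 2 by norm_num) ν).ne'
    field_simp

/-- Gaussians are positive semidefinite functions. -/
theorem gaussian_sum_nonneg {d : ℕ} {ι : Type*} (S : Finset ι) (w : ι → ℝ)
    (y : ι → EuclideanSpace ℝ (Fin d)) {c : ℝ} (hc : 0 ≤ c) :
    0 ≤ ∑ i ∈ S, ∑ j ∈ S, w i * w j * Real.exp (-(c * ‖y i - y j‖ ^ 2)) := by
  set μ := ProbabilityTheory.stdGaussian (EuclideanSpace ℝ (Fin d)) with hμ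
  set k : ℝ := √(2 * c) with hk
  have hk2 : k ^ 2 = 2 * c := Real.sq_sqrt (by positivity)
  have hint : ∀ t : EuclideanSpace ℝ (Fin d),
      Integrable (fun v => Real.cos (inner ℝ v t)) μ := by
    intro t
    refine Integrable.mono' (integrable_const (1 : ℝ)) ?_ ?_
    · exact (Continuous.aestronglyMeasurable (by fun_prop))
    · exact Filter.Eventually.of_forall fun v => by
        simpa using Real.abs_cos_le_one _
  have hexp : ∀ t : EuclideanSpace ℝ (Fin d),
      Real.exp (-(c * ‖t‖ ^ 2)) = ∫ v, Real.cos (inner ℝ v (k • t)) ∂μ := by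
    intro t
    have h1 := ProbabilityTheory.charFun_stdGaussian (k • t)
    rw [charFun_apply] at h1
    have h2 := congrArg Complex.re h1
    have hi : Integrable (fun v => Complex.exp ((inner ℝ v (k • t) : ℝ) * Complex.I)) μ := by
      refine Integrable.mono' (integrable_const (1 : ℝ)) ?_ ?_
      · exact (Continuous.aestronglyMeasurable (by fun_prop))
      · exact Filter.Eventually.of_forall fun v => by
          rw [Complex.norm_exp_ofReal_mul_I]
    have h3 := integral_re (𝕜 := ℂ) hi
    simp only [RCLike.re_to_complex, Complex.exp_ofReal_mul_I_re] at h3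
    rw [h3, h2]
    have h4 : (-((‖k • t‖ : ℝ) : ℂ) ^ 2 / 2) = ((-(c * ‖t‖ ^ 2) : ℝ) : ℂ) := by
      rw [norm_smul, Real.norm_of_nonneg (Real.sqrt_nonneg _)]
      have : -(k * ‖t‖) ^ 2 / 2 = -(c * ‖t‖ ^ 2) := by rw [mul_pow, hk2]; ring
      rw [← this]; push_cast; ring
    rw [h4, ← Complex.ofReal_exp, Complex.ofReal_re]
  have hsum : ∑ i ∈ S, ∑ j ∈ S, w i * w j * Real.exp (-(c * ‖y i - y j‖ ^ 2)) =
      ∫ v, ((∑ i ∈ S, w i * Real.cos (inner ℝ v (k • y i))) ^ 2 +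
        (∑ i ∈ S, w i * Real.sin (inner ℝ v (k • y i))) ^ 2) ∂μ := by
    have hp : ∀ v, ((∑ i ∈ S, w i * Real.cos (inner ℝ v (k • y i))) ^ 2 +
        (∑ i ∈ S, w i * Real.sin (inner ℝ v (k • y i))) ^ 2) =
        ∑ i ∈ S, ∑ j ∈ S, w i * w j * Real.cos (inner ℝ v (k • (y i - y j))) := by
      intro v
      rw [sq, sq, Finset.sum_mul_sum, Finset.sum_mul_sum, ← Finset.sum_add_distrib]
      refine Finset.sum_congr rfl fun i _ => ?_
      rw [← Finset.sum_add_distrib]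
      refine Finset.sum_congr rfl fun j _ => ?_
      rw [smul_sub, inner_sub_right, Real.cos_sub]
      ring
    simp only [hp]
    rw [integral_finsetSum _ fun i _ => integrable_finsetSum _ fun j _ => (hint _).const_mul _]
    refine Finset.sum_congr rfl fun i _ => ?_
    rw [integral_finsetSum _ fun j _ => (hint _).const_mul _]
    refine Finset.sum_congr rfl fun j _ => ?_
    rw [integral_const_mul, hexp]
  rw [hsum]
  exact integral_nonneg fun v => by positivity

/-- The Matérn kernel is positive semidefinite. -/
theorem maternKernel_sum_nonneg {d : ℕ} (p : MaternParams d) {ι : Type*} (S : Finset ι)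
    (w : ι → ℝ) (y : ι → EuclideanSpace ℝ (Fin d)) :
    0 ≤ ∑ i ∈ S, ∑ j ∈ S, w i * w j * maternKernel p (y i) (y j) := by
  set A := Matrix.toEuclideanCLM (n := Fin d) (𝕜 := ℝ) p.Θ⁻¹ with hA
  have hν := p.ν_pos
  set G : ι → ι → ℝ → ℝ := fun i j s => (Real.exp (-s) * s ^ (p.ν - 1)) *
    Real.exp (-(p.ν * ‖A (y i - y j)‖ ^ 2 / 2 / s)) with hG
  have hint : ∀ i j, IntegrableOn (G i j) (Ioi 0) := fun i j =>
    integrableOn_maternMixture hν (by positivity)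
  have h1 : ∑ i ∈ S, ∑ j ∈ S, w i * w j * maternKernel p (y i) (y j) =
      1 / Real.Gamma p.ν * ∫ s in Ioi (0 : ℝ), ∑ i ∈ S, ∑ j ∈ S, w i * w j * G i j s := by
    rw [integral_finsetSum _ fun i _ =>
      integrable_finsetSum _ fun j _ => (hint i j).const_mul _, Finset.mul_sum]
    refine Finset.sum_congr rfl fun i _ => ?_
    rw [integral_finsetSum _ fun j _ => (hint i j).const_mul _, Finset.mul_sum]
    refine Finset.sum_congr rfl fun j _ => ?_
    rw [integral_const_mul, maternKernel, maternRadial_eq_integral hν (norm_nonneg _)]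
    ring
  rw [h1]
  refine mul_nonneg (one_div_nonneg.2 (Real.Gamma_pos_of_pos hν).le) ?_
  refine setIntegral_nonneg measurableSet_Ioi fun s hs => ?_
  have hs' : (0 : ℝ) < s := hs
  have h2 := gaussian_sum_nonneg S w (fun i => A (y i)) (c := p.ν / 2 / s) (by positivity)
  have h3 : ∑ i ∈ S, ∑ j ∈ S, w i * w j * G i j s = (Real.exp (-s) * s ^ (p.ν - 1)) *
      ∑ i ∈ S, ∑ j ∈ S, w i * w j * Real.exp (-(p.ν / 2 / s * ‖A (y i) - A (y j)‖ ^ 2)) := by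
    rw [Finset.mul_sum]
    refine Finset.sum_congr rfl fun i _ => ?_
    rw [Finset.mul_sum]
    refine Finset.sum_congr rfl fun j _ => ?_
    simp only [hG, map_sub]
    have : p.ν * ‖A (y i) - A (y j)‖ ^ 2 / 2 / s = p.ν / 2 / s * ‖A (y i) - A (y j)‖ ^ 2 := by
      ring
    rw [this]; ring
  rw [h3]
  positivity

theorem maternKernel_comm {d : ℕ} (p : MaternParams d) (x y : EuclideanSpace ℝ (Fin d)) :
    maternKernel p x y = maternKernel p y x := by
  rw [maternKernel, maternKernel, ← neg_sub y x, map_neg, norm_neg]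

/-- The Matérn kernel on `Ω × Ω` in the operator-valued form of Mathlib's reproducing kernel
Hilbert spaces: the number `Φ(x, y)` acts on `ℝ` by multiplication. -/
def maternOp {d : ℕ} (p : MaternParams d) (Ω : Set (EuclideanSpace ℝ (Fin d))) :
    Matrix Ω Ω (ℝ →L[ℝ] ℝ) :=
  Matrix.of fun x y => maternKernel p x y • ContinuousLinearMap.id ℝ ℝ

instance maternOp_posSemidef {d : ℕ} (p : MaternParams d)
    (Ω : Set (EuclideanSpace ℝ (Fin d))) : Fact (maternOp p Ω).PosSemidef := by
  have key : (maternOp p Ω).IsHermitian ∧ ∀ w : Ω →₀ ℝ, 0 ≤ RCLike.re (K := ℝ)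
      (w.sum fun x a => w.sum fun y b => inner ℝ (maternOp p Ω y x a) b) := by
    refine ⟨?_, fun w => ?_⟩
    · have hs : star (ContinuousLinearMap.id ℝ ℝ) = ContinuousLinearMap.id ℝ ℝ :=
        star_one (ℝ →L[ℝ] ℝ)
      ext x y
      simp [hs, maternOp, maternKernel_comm p (x : EuclideanSpace ℝ (Fin d)) y]
    · have h := maternKernel_sum_nonneg p w.support w
        (fun i : Ω => (i : EuclideanSpace ℝ (Fin d)))
      refine h.trans_eq ?_
      simp only [Finsupp.sum, maternOp, Matrix.of_apply, RCLike.re_to_real]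
      refine Finset.sum_congr rfl fun x _ => Finset.sum_congr rfl fun y _ => ?_
      rw [maternKernel_comm p (x : EuclideanSpace ℝ (Fin d)) y]
      simp [mul_comm, mul_left_comm]
  exact ⟨(RKHS.posSemidef_tfae.out 0 2).2 key⟩

/-- The native space (reproducing kernel Hilbert space) of the Matérn kernel on `Ω`: the
completion of the span of the functions `Φ(·, y)`, `y ∈ Ω`, for `⟪Φ(·, x), Φ(·, y)⟫ = Φ(x, y)`. -/
abbrev MaternRKHS {d : ℕ} (p : MaternParams d) (Ω : Set (EuclideanSpace ℝ (Fin d))) : Type :=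
  RKHS.OfKernel (maternOp p Ω)

/-- The native space as a set of functions on `Ω`. -/
def nativeSpace {d : ℕ} (p : MaternParams d) (Ω : Set (EuclideanSpace ℝ (Fin d))) :
    Set (Ω → ℝ) :=
  Set.range fun g : MaternRKHS p Ω => (⇑g : Ω → ℝ)

open Classical in
/-- The native space norm of a function in the native space: the norm of the unique element of the
Hilbert space which represents it (and `0` for all other functions). -/
def nativeNorm {d : ℕ} (p : MaternParams d) (Ω : Set (EuclideanSpace ℝ (Fin d)))
    (f : Ω → ℝ) : ℝ :=
  if h : f ∈ nativeSpace p Ω then ‖Classical.choose h‖ else 0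

theorem nativeNorm_coe {d : ℕ} (p : MaternParams d) (Ω : Set (EuclideanSpace ℝ (Fin d)))
    (g : MaternRKHS p Ω) : nativeNorm p Ω (⇑g) = ‖g‖ := by
  have h : (⇑g : Ω → ℝ) ∈ nativeSpace p Ω := ⟨g, rfl⟩
  rw [nativeNorm, dif_pos h]
  have := Classical.choose_spec h
  rw [DFunLike.coe_injective this]

/-- The fill distance `sup_{x ∈ Ω} min_{u ∈ X} ‖x - u‖₂` of a finite nonempty design `X ⊆ Ω`. -/
def fillDistance {d : ℕ} {Ω : Set (EuclideanSpace ℝ (Fin d))} (X : Finset Ω) : ℝ :=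
  ⨆ x : Ω, ⨅ u : X, ‖(x : EuclideanSpace ℝ (Fin d)) - (u : Ω)‖

/-- The kernel matrix `[Φ(u, v)]` of a design. -/
def gramMatrix {d : ℕ} (p : MaternParams d) {Ω : Set (EuclideanSpace ℝ (Fin d))}
    (X : Finset Ω) : Matrix X X ℝ :=
  Matrix.of fun u v => maternKernel p (u : Ω) (v : Ω)

/-- The kernel interpolant `∑_u α_u Φ(x, u)` of the data `z|_X`, with `α = Φ(X, X)⁻¹ z|_X`. -/
def kernelInterpolant {d : ℕ} (p : MaternParams d) {Ω : Set (EuclideanSpace ℝ (Fin d))}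
    (X : Finset Ω) (z : Ω → ℝ) (x : Ω) : ℝ :=
  ∑ u : X, (Matrix.mulVec (gramMatrix p X)⁻¹ fun v : X => z v) u * maternKernel p x (u : Ω)

/-- The multi-level interpolator `∑_{l=1}^L P_l`, where `P_l` interpolates the refinement
`f_l - f_{l-1}` on the design `X_l` with the `l`-th kernel. -/
def multilevelInterpolator {d : ℕ} {Ω : Set (EuclideanSpace ℝ (Fin d))} (L : ℕ)
    (p : ℕ → MaternParams d) (X : ℕ → Finset Ω) (f : ℕ → Ω → ℝ) (x : Ω) : ℝ :=
  ∑ l ∈ Finset.Icc 1 L, kernelInterpolant (p l) (X l) (f l - f (l - 1)) x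

end

/-! Since `f 0 = 0`, the error telescopes into the single-level errors of the increments `f l - f (l
- 1)`, so everything rests on one estimate for a single Matérn kernel whose constant is uniform in
the parameters (`exists_kernelInterpolant_error_bound`).

For one level, `abs_sub_kernelInterpolant_le` is the power function argument. The interpolation
residual vanishes on the design, so its value at `x` is its inner product with the representer of
any functional "evaluation at `x` plus weighted evaluations at design points". The squared norm of
that representer is a quadratic form of the kernel, and the weights are free.

Choose weights that make the functional annihilate polynomials of degree at most `2 * N`, with
bounded absolute sum and nodes at distance `O(h)` from `x`. The kernel is a mixture over `s` of
Gaussians. In each Gaussian form the Taylor polynomial of order `N` cancels, which leaves a multiple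
of `min 1 ((τ / s) ^ (N + 1))` with `τ` of order `(‖Θ⁻¹‖ h) ^ 2`. Integrating against `s ^ (ν - 1)`
gives `τ ^ ν`, the square of the desired rate (`maternKernel_sum_le_of_annihilates`). The constants
are explicit and continuous in `ν`, hence bounded on `[νmin, νmax]`.

Such weights come from a compactness argument near a grid where interpolation is unisolvent,
transported to `x` by shrinking `Ω` towards `x`, which convexity allows
(`Convex.exists_local_polynomial_reproduction`). -/

open Filter Topology

/-! ### Strict positive definiteness -/

/-- The quadratic form of the Matérn kernel as a mixture of Gaussian quadratic forms. -/
theorem maternKernel_sum_eq_integral {d : ℕ} (p : MaternParams d) {J : Type*} [Fintype J]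
    (w : J → ℝ) (y : J → EuclideanSpace ℝ (Fin d)) :
    IntegrableOn (fun s : ℝ => (Real.exp (-s) * s ^ (p.ν - 1)) * ∑ i, ∑ j, w i * w j *
      Real.exp (-(p.ν / 2 / s * ‖Matrix.toEuclideanCLM (n := Fin d) (𝕜 := ℝ) p.Θ⁻¹
        (y i - y j)‖ ^ 2))) (Ioi 0) ∧
    ∑ i, ∑ j, w i * w j * maternKernel p (y i) (y j) = 1 / Real.Gamma p.ν *
      ∫ s in Ioi (0 : ℝ), (Real.exp (-s) * s ^ (p.ν - 1)) * ∑ i, ∑ j, w i * w j *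
        Real.exp (-(p.ν / 2 / s * ‖Matrix.toEuclideanCLM (n := Fin d) (𝕜 := ℝ) p.Θ⁻¹
          (y i - y j)‖ ^ 2)) := by
  set A := Matrix.toEuclideanCLM (n := Fin d) (𝕜 := ℝ) p.Θ⁻¹ with hA
  have hν := p.ν_pos
  set G : J → J → ℝ → ℝ := fun i j s => (Real.exp (-s) * s ^ (p.ν - 1)) *
    Real.exp (-(p.ν * ‖A (y i - y j)‖ ^ 2 / 2 / s)) with hG
  have hint : ∀ i j, IntegrableOn (G i j) (Ioi 0) := fun i j =>
    integrableOn_maternMixture hν (by positivity)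
  have hfun : (fun s : ℝ => (Real.exp (-s) * s ^ (p.ν - 1)) * ∑ i, ∑ j, w i * w j *
      Real.exp (-(p.ν / 2 / s * ‖A (y i - y j)‖ ^ 2))) =
      fun s => ∑ i, ∑ j, w i * w j * G i j s := by
    funext s
    rw [Finset.mul_sum]
    refine Finset.sum_congr rfl fun i _ => ?_
    rw [Finset.mul_sum]
    refine Finset.sum_congr rfl fun j _ => ?_
    have : p.ν * ‖A (y i - y j)‖ ^ 2 / 2 / s = p.ν / 2 / s * ‖A (y i - y j)‖ ^ 2 := by ring
    simp only [hG, this]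
    ring
  rw [hfun]
  refine ⟨integrable_finsetSum _ fun i _ => integrable_finsetSum _ fun j _ =>
    (hint i j).const_mul _, ?_⟩
  rw [integral_finsetSum _ fun i _ =>
    integrable_finsetSum _ fun j _ => (hint i j).const_mul _, Finset.mul_sum]
  refine Finset.sum_congr rfl fun i _ => ?_
  rw [integral_finsetSum _ fun j _ => (hint i j).const_mul _, Finset.mul_sum]
  refine Finset.sum_congr rfl fun j _ => ?_
  rw [integral_const_mul, maternKernel, maternRadial_eq_integral hν (norm_nonneg _)]
  ring

theorem gaussian_sum_map_sub_nonneg {d : ℕ} {J : Type*} [Fintype J] (w : J → ℝ)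
    (A : EuclideanSpace ℝ (Fin d) →L[ℝ] EuclideanSpace ℝ (Fin d))
    (y : J → EuclideanSpace ℝ (Fin d)) {c : ℝ} (hc : 0 ≤ c) :
    0 ≤ ∑ i, ∑ j, w i * w j * Real.exp (-(c * ‖A (y i - y j)‖ ^ 2)) := by
  simpa only [map_sub] using gaussian_sum_nonneg Finset.univ w (fun i => A (y i)) hc

theorem MaternParams.inv_Θ {d : ℕ} (p : MaternParams d) :
    p.Θ⁻¹ = Matrix.diagonal fun i => (p.θ i)⁻¹ := by
  refine Matrix.inv_eq_left_inv ?_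
  rw [MaternParams.Θ, Matrix.diagonal_mul_diagonal]
  simp [(p.θ_pos _).ne']

theorem MaternParams.toEuclideanCLM_inv_Θ_injective {d : ℕ} (p : MaternParams d) :
    Function.Injective (Matrix.toEuclideanCLM (n := Fin d) (𝕜 := ℝ) p.Θ⁻¹) := by
  intro x y hxy
  ext i
  have h := congrArg (fun v : EuclideanSpace ℝ (Fin d) => v i) hxy
  simpa [p.inv_Θ, Matrix.mulVec_diagonal, (p.θ_pos i).ne'] using h

/-- The Matérn kernel is strictly positive definite. -/
theorem maternKernel_sum_pos {d : ℕ} (p : MaternParams d) {J : Type*} [Fintype J]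
    (w : J → ℝ) (hw : w ≠ 0) (y : J → EuclideanSpace ℝ (Fin d)) (hy : Function.Injective y) :
    0 < ∑ i, ∑ j, w i * w j * maternKernel p (y i) (y j) := by
  classical
  obtain ⟨hint, heq⟩ := maternKernel_sum_eq_integral p w y
  have hν := p.ν_pos
  rw [heq]
  refine mul_pos (one_div_pos.2 (Real.Gamma_pos_of_pos hν)) ?_
  set A := Matrix.toEuclideanCLM (n := Fin d) (𝕜 := ℝ) p.Θ⁻¹ with hA
  set g : ℝ → ℝ := fun s => ∑ i, ∑ j, w i * w j *
    Real.exp (-(p.ν / 2 / s * ‖A (y i - y j)‖ ^ 2)) with hg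
  have hg0 : ∀ s, 0 < s → 0 ≤ g s := fun s hs =>
    gaussian_sum_map_sub_nonneg w A y (by positivity)
  -- As `s → 0` the Gaussians become infinitely narrow and the form tends to `∑ w i ^ 2 > 0`. The
  -- mixture integrand is therefore positive on an interval next to `0`.
  have hlim : Tendsto g (𝓝[>] 0) (𝓝 (∑ i, ∑ j, w i * w j * if i = j then 1 else 0)) := by
    refine tendsto_finsetSum _ fun i _ => tendsto_finsetSum _ fun j _ => ?_
    refine Tendsto.const_mul _ ?_
    split_ifs with hij
    · have h1 : ∀ s : ℝ, Real.exp (-(p.ν / 2 / s * ‖A (y i - y j)‖ ^ 2)) = 1 := fun s => by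
        rw [hij, sub_self, map_zero, norm_zero, sq, mul_zero, mul_zero, neg_zero, Real.exp_zero]
      simpa only [h1] using tendsto_const_nhds
    · refine Real.tendsto_exp_atBot.comp (tendsto_neg_atTop_atBot.comp ?_)
      have hpos : 0 < ‖A (y i - y j)‖ ^ 2 := by
        have : A (y i - y j) ≠ 0 := fun h0 => hij (hy (sub_eq_zero.1
          (p.toEuclideanCLM_inv_Θ_injective (by rw [← hA, h0, map_zero]))))
        positivity
      refine Tendsto.atTop_mul_const hpos ?_
      change Tendsto (fun s : ℝ => p.ν / 2 / s) _ _
      simp only [div_eq_mul_inv (p.ν / 2)]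
      exact tendsto_inv_nhdsGT_zero.const_mul_atTop (by positivity)
  have hlim0 : 0 < ∑ i, ∑ j, w i * w j * (if i = j then (1 : ℝ) else 0) := by
    simp only [mul_ite, mul_one, mul_zero, Finset.sum_ite_eq, Finset.mem_univ, if_true]
    obtain ⟨i, hi⟩ := Function.ne_iff.1 hw
    refine Finset.sum_pos' (fun i _ => mul_self_nonneg _) ⟨i, Finset.mem_univ _, ?_⟩
    exact mul_self_pos.2 hi
  have hev : ∀ᶠ s in 𝓝[>] (0 : ℝ), 0 < g s := hlim.eventually_const_lt hlim0
  obtain ⟨ε, hε, hεs⟩ := mem_nhdsGT_iff_exists_Ioo_subset.1 hev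
  have hε' : (0 : ℝ) < ε := hε
  rw [setIntegral_pos_iff_support_of_nonneg_ae _ hint]
  · refine lt_of_lt_of_le ?_ (measure_mono (s := Ioo 0 ε) ?_)
    · simpa using hε'
    · intro s hs
      refine ⟨?_, hs.1⟩
      have h1 : 0 < g s := hεs hs
      have h2 : (0 : ℝ) < s ^ (p.ν - 1) := Real.rpow_pos_of_pos hs.1 _
      exact (mul_pos (mul_pos (Real.exp_pos _) h2) h1).ne'
  · filter_upwards [ae_restrict_mem measurableSet_Ioi] with s hs
    have hs' : (0 : ℝ) < s := hs
    exact mul_nonneg (by positivity) (hg0 s hs')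

theorem maternKernel_self {d : ℕ} (p : MaternParams d) (x : EuclideanSpace ℝ (Fin d)) :
    maternKernel p x x = 1 := by
  simp [maternKernel, maternRadial]

/-- A kernel vector of the matrix would be a zero of the strictly positive quadratic form.
Invertibility guarantees that the interpolant defined with `⁻¹` matches the data. -/
theorem isUnit_det_gramMatrix {d : ℕ} (p : MaternParams d) {Ω : Set (EuclideanSpace ℝ (Fin d))}
    (X : Finset Ω) : IsUnit (gramMatrix p X).det := by
  classical
  rw [isUnit_iff_ne_zero]
  intro h0
  obtain ⟨v, hv, hMv⟩ := Matrix.exists_mulVec_eq_zero_iff.2 h0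
  have hpos := maternKernel_sum_pos p v hv (fun u : X => ((u : Ω) : EuclideanSpace ℝ (Fin d)))
    (Subtype.val_injective.comp Subtype.val_injective)
  refine hpos.ne' ?_
  refine Finset.sum_eq_zero fun i _ => ?_
  have h := congrFun hMv i
  simp only [Matrix.mulVec, dotProduct, gramMatrix, Matrix.of_apply, Pi.zero_apply] at h
  calc _ = v i * ∑ j : X, maternKernel p (i : Ω) (j : Ω) * v j := by
        rw [Finset.mul_sum]; exact Finset.sum_congr rfl fun j _ => by ring
    _ = 0 := by rw [h, mul_zero]

/-! ### Error bounds in the native space and telescoping -/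

/-- The pointwise error of kernel interpolation is controlled by the native space norm and by
the quadratic form of any weights supported on the design and the evaluation point. -/
theorem abs_sub_kernelInterpolant_le {d : ℕ} (p : MaternParams d)
    {Ω : Set (EuclideanSpace ℝ (Fin d))} (X : Finset Ω) (z : Ω → ℝ) (hz : z ∈ nativeSpace p Ω)
    (x : Ω) {J : Type*} [Fintype J] (a : J → ℝ) (y : J → Ω) (hy : ∀ j, y j ∈ X) {q : ℝ}
    (hq : ∑ i : Option J, ∑ j : Option J, i.elim 1 a * j.elim 1 a *
      maternKernel p ((i.elim x y : Ω) : EuclideanSpace ℝ (Fin d)) (j.elim x y : Ω) ≤ q ^ 2) (hq0 : 0 ≤ q) :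
    |z x - kernelInterpolant p X z x| ≤ q * nativeNorm p Ω z := by
  classical
  obtain ⟨g, rfl⟩ := hz
  simp only [nativeNorm_coe]
  set k : Ω → MaternRKHS p Ω := fun u => RKHS.kerFun (MaternRKHS p Ω) u (1 : ℝ) with hk
  have hkg : ∀ (u : Ω) (f : MaternRKHS p Ω), inner ℝ (k u) f = f u := fun u f => by
    rw [hk, RKHS.kerFun_inner]; simp
  have hkk : ∀ u v : Ω, k u v = maternKernel p v u := fun u v => by
    rw [hk]
    simp only
    rw [RKHS.kerFun_apply, RKHS.OfKernel.kernel_ofKernel]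
    simp [maternOp]
  set α : X → ℝ := Matrix.mulVec (gramMatrix p X)⁻¹ fun v : X => g v with hα
  set s : MaternRKHS p Ω := ∑ u, α u • k u with hs
  have hsx : ∀ v : Ω, s v = ∑ u, α u * maternKernel p v (u : Ω) := fun v => by
    rw [← hkg, hs, inner_sum]
    refine Finset.sum_congr rfl fun u _ => ?_
    rw [inner_smul_right, hkg, hkk]
  have hsI : ∀ v : Ω, kernelInterpolant p X g v = s v := fun v => by
    rw [hsx, kernelInterpolant]
  have hsX : ∀ v ∈ X, (g - s) v = 0 := by
    intro v hv
    have h1 : Matrix.mulVec (gramMatrix p X) α = fun v : X => g v := by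
      rw [hα, Matrix.mulVec_mulVec, Matrix.mul_nonsing_inv _ (isUnit_det_gramMatrix p X),
        Matrix.one_mulVec]
    have h2 := congrFun h1 ⟨v, hv⟩
    simp only [Matrix.mulVec, dotProduct, gramMatrix, Matrix.of_apply] at h2
    rw [RKHS.coe_sub, Pi.sub_apply, ← h2, hsx, sub_eq_zero]
    exact Finset.sum_congr rfl fun u _ => by ring
  -- The residual vanishes on `X`, hence is orthogonal to every `k u` with `u ∈ X`; Pythagoras then
  -- bounds its norm by that of `g`.
  have horth : inner ℝ s (g - s) = 0 := by
    rw [hs, sum_inner]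
    refine Finset.sum_eq_zero fun u _ => ?_
    rw [inner_smul_left, ← hs, hkg, hsX _ u.2, mul_zero]
  have hnorm : ‖g - s‖ ≤ ‖g‖ := by
    have h1 : ‖s + (g - s)‖ * ‖s + (g - s)‖ = ‖s‖ * ‖s‖ + ‖g - s‖ * ‖g - s‖ :=
      norm_add_sq_eq_norm_sq_add_norm_sq_of_inner_eq_zero _ _ horth
    rw [add_sub_cancel] at h1
    exact le_of_sq_le_sq (by nlinarith [mul_self_nonneg ‖s‖]) (norm_nonneg _)
  -- The index `none` carries the evaluation point `x` with weight `1`, and `some j` the node `y j`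
  -- with weight `a j`.
  set P : MaternRKHS p Ω := ∑ i : Option J, i.elim 1 a • k (i.elim x y) with hP
  have hPq : ‖P‖ ≤ q := by
    refine le_of_sq_le_sq (le_trans (le_of_eq ?_) hq) hq0
    rw [← real_inner_self_eq_norm_sq, hP, sum_inner]
    refine Finset.sum_congr rfl fun i _ => ?_
    rw [inner_sum]
    refine Finset.sum_congr rfl fun j _ => ?_
    rw [inner_smul_left, inner_smul_right, hkg, hkk]
    simp [mul_assoc]
  have hval : g x - kernelInterpolant p X g x = inner ℝ P (g - s) := by
    rw [hsI, hP, sum_inner, Fintype.sum_option]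
    simp only [inner_smul_left, hkg, Option.elim, hsX _ (hy _), RCLike.conj_to_real, mul_zero,
      Finset.sum_const_zero, add_zero, one_mul, RKHS.coe_sub, Pi.sub_apply]
  rw [hval]
  exact (abs_real_inner_le_norm _ _).trans (mul_le_mul hPq hnorm (norm_nonneg _) hq0)

theorem multilevelInterpolator_error_le {d : ℕ} {Ω : Set (EuclideanSpace ℝ (Fin d))} (L : ℕ)
    (p : ℕ → MaternParams d) (X : ℕ → Finset Ω) (f : ℕ → Ω → ℝ) (hf : f 0 = 0) (x : Ω)
    (e : ℕ → ℝ) (he : ∀ l ∈ Finset.Icc 1 L,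
      |(f l - f (l - 1)) x - kernelInterpolant (p l) (X l) (f l - f (l - 1)) x| ≤ e l) :
    |f L x - multilevelInterpolator L p X f x| ≤ ∑ l ∈ Finset.Icc 1 L, e l := by
  have htel : f L x = ∑ l ∈ Finset.Icc 1 L, (f l - f (l - 1)) x := by
    clear he
    induction L with
    | zero => simp [hf]
    | succ n ih =>
      rw [Finset.sum_Icc_succ_top (by omega), ← ih]
      simp
  rw [htel, multilevelInterpolator, ← Finset.sum_sub_distrib]
  exact (Finset.abs_sum_le_sum_abs _ _).trans (Finset.sum_le_sum he)

/-! ### Quadratic forms of weights that annihilate polynomials -/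

theorem exists_mvPolynomial_eval_eq_linearMap {k : ℕ} (φ : EuclideanSpace ℝ (Fin k) →ₗ[ℝ] ℝ) :
    ∃ q : MvPolynomial (Fin k) ℝ, q.totalDegree ≤ 1 ∧
      ∀ y : EuclideanSpace ℝ (Fin k), MvPolynomial.eval y q = φ y := by
  refine ⟨∑ i, MvPolynomial.C (φ (EuclideanSpace.single i 1)) * MvPolynomial.X i, ?_, fun y => ?_⟩
  · refine MvPolynomial.totalDegree_finsetSum_le fun i _ => ?_
    refine (MvPolynomial.totalDegree_mul _ _).trans ?_
    simp [MvPolynomial.totalDegree_C, MvPolynomial.totalDegree_X]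
  · have hy : y = ∑ i, y i • EuclideanSpace.single i (1 : ℝ) := by
      ext j
      simp [Finset.sum_apply, Pi.single_apply]
    conv_rhs => rw [hy]
    simp [mul_comm]

/-- Each coordinate of `B (w - y)` is affine in `y`. These are the Taylor terms of a Gaussian
centred at `w`, up to scalar factors. -/
theorem exists_mvPolynomial_eval_eq_norm_pow {k d : ℕ}
    (B : EuclideanSpace ℝ (Fin k) →L[ℝ] EuclideanSpace ℝ (Fin d))
    (w : EuclideanSpace ℝ (Fin k)) (n : ℕ) :
    ∃ q : MvPolynomial (Fin k) ℝ, q.totalDegree ≤ 2 * n ∧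
      ∀ y : EuclideanSpace ℝ (Fin k), MvPolynomial.eval y q = (‖B (w - y)‖ ^ 2) ^ n := by
  choose q hq1 hq2 using fun l : Fin d => exists_mvPolynomial_eval_eq_linearMap
    ((EuclideanSpace.proj l : EuclideanSpace ℝ (Fin d) →L[ℝ] ℝ).comp B).toLinearMap
  refine ⟨(∑ l, (MvPolynomial.C (B w l) - q l) ^ 2) ^ n, ?_, fun y => ?_⟩
  · refine (MvPolynomial.totalDegree_pow _ _).trans ?_
    rw [mul_comm 2 n]
    refine Nat.mul_le_mul_left n ?_
    refine MvPolynomial.totalDegree_finsetSum_le fun l _ => ?_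
    refine (MvPolynomial.totalDegree_pow _ _).trans ?_
    have : (MvPolynomial.C (B w l) - q l).totalDegree ≤ 1 := by
      refine (MvPolynomial.totalDegree_sub _ _).trans ?_
      simpa [MvPolynomial.totalDegree_C] using hq1 l
    omega
  · rw [map_pow, map_sum, EuclideanSpace.norm_sq_eq]
    congr 1
    refine Finset.sum_congr rfl fun l _ => ?_
    rw [map_pow, map_sub, hq2, MvPolynomial.eval_C]
    simp

theorem abs_sum_sum_mul_le {J : Type*} [Fintype J] (b : J → ℝ) {K r : ℝ}
    (hK : ∑ j, |b j| ≤ K) (hr : 0 ≤ r) (F : J → J → ℝ) (hF : ∀ i j, |F i j| ≤ r) :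
    |∑ i, ∑ j, b i * b j * F i j| ≤ K ^ 2 * r := by
  have hS : 0 ≤ ∑ j, |b j| := Finset.sum_nonneg fun _ _ => abs_nonneg _
  calc |∑ i, ∑ j, b i * b j * F i j| ≤ ∑ i, ∑ j, |b i| * |b j| * r := by
        refine (Finset.abs_sum_le_sum_abs _ _).trans (Finset.sum_le_sum fun i _ => ?_)
        refine (Finset.abs_sum_le_sum_abs _ _).trans (Finset.sum_le_sum fun j _ => ?_)
        rw [abs_mul, abs_mul]
        exact mul_le_mul_of_nonneg_left (hF i j) (by positivity)
    _ = (∑ j, |b j|) ^ 2 * r := by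
        rw [sq, Finset.sum_mul_sum, Finset.sum_mul]
        exact Finset.sum_congr rfl fun i _ => by rw [Finset.sum_mul]
    _ ≤ K ^ 2 * r := by gcongr

/-- A Gaussian quadratic form is small if the weights annihilate polynomials and the points are
close to each other relative to the width of the Gaussian. -/
theorem gaussian_sum_le_of_annihilates {k d N : ℕ} {J : Type*} [Fintype J] (b : J → ℝ) {K : ℝ}
    (hK : ∑ j, |b j| ≤ K) (η : J → EuclideanSpace ℝ (Fin k))
    (hb : ∀ q : MvPolynomial (Fin k) ℝ, q.totalDegree ≤ 2 * N →
      ∑ j, b j * MvPolynomial.eval (η j) q = 0)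
    (B : EuclideanSpace ℝ (Fin k) →L[ℝ] EuclideanSpace ℝ (Fin d)) {c x : ℝ} (hc : 0 ≤ c)
    (hx : ∀ i j, c * ‖B (η i - η j)‖ ^ 2 ≤ x) (hx0 : 0 ≤ x) :
    ∑ i, ∑ j, b i * b j * Real.exp (-(c * ‖B (η i - η j)‖ ^ 2)) ≤
      2 * K ^ 2 * min 1 (x ^ (N + 1)) := by
  rcases le_or_gt x 1 with hx1 | hx1
  · have hmin : min 1 (x ^ (N + 1)) = x ^ (N + 1) := min_eq_right (pow_le_one₀ hx0 hx1)
    rw [hmin]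
    set u : J → J → ℝ := fun i j => -(c * ‖B (η i - η j)‖ ^ 2) with hu
    have hu0 : ∀ i j, 0 ≤ c * ‖B (η i - η j)‖ ^ 2 := fun i j => by positivity
    -- With `i` fixed, the Taylor sum is a polynomial in `η j` of degree at most `2 * N`, so
    -- annihilation in the second index alone suffices.
    have htay : ∀ i, ∑ j, b j * ∑ n ∈ Finset.range (N + 1), u i j ^ n / n.factorial = 0 := by
      intro i
      simp only [Finset.mul_sum]
      rw [Finset.sum_comm]
      refine Finset.sum_eq_zero fun n hn => ?_
      obtain ⟨q, hq1, hq2⟩ := exists_mvPolynomial_eval_eq_norm_pow B (η i) n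
      have h := hb q (hq1.trans (by have := Finset.mem_range.1 hn; omega))
      calc _ = ∑ j, ((-c) ^ n / n.factorial) * (b j * MvPolynomial.eval (η j) q) := by
            refine Finset.sum_congr rfl fun j _ => ?_
            rw [hq2, hu]
            simp only
            rw [← neg_mul, mul_pow]
            ring
        _ = 0 := by rw [← Finset.mul_sum, h, mul_zero]
    have hsub : ∑ i, ∑ j, b i * b j * Real.exp (u i j) = ∑ i, ∑ j, b i * b j *
        (Real.exp (u i j) - ∑ n ∈ Finset.range (N + 1), u i j ^ n / n.factorial) := by
      refine Finset.sum_congr rfl fun i _ => ?_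
      have h := htay i
      simp only [mul_sub, Finset.sum_sub_distrib, mul_assoc]
      rw [← Finset.mul_sum (a := b i) (f := fun j => b j *
        ∑ n ∈ Finset.range (N + 1), u i j ^ n / n.factorial), h, mul_zero, sub_zero]
    change ∑ i, ∑ j, b i * b j * Real.exp (u i j) ≤ _
    rw [hsub]
    refine (le_abs_self _).trans ((abs_sum_sum_mul_le b hK (r := 2 * x ^ (N + 1)) (by positivity) _
      fun i j => ?_).trans_eq (by ring))
    have habs : |u i j| ≤ x := by
      rw [hu]; simp only; rw [abs_neg, abs_of_nonneg (hu0 i j)]; exact hx i j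
    -- The remainder constant `(N + 2) / ((N + 1)! * (N + 1))` is at most `2`.
    refine (Real.exp_bound (habs.trans hx1) (Nat.succ_pos N)).trans ?_
    rw [mul_comm]
    refine mul_le_mul ?_ (pow_le_pow_left₀ (abs_nonneg _) habs _) (by positivity) (by norm_num)
    have h1 : (1 : ℝ) ≤ (N + 1).factorial := by exact_mod_cast Nat.succ_le_of_lt (Nat.factorial_pos _)
    rw [div_le_iff₀ (by positivity)]
    push_cast
    nlinarith
  · rw [min_eq_left (one_le_pow₀ hx1.le)]
    refine (le_abs_self _).trans ((abs_sum_sum_mul_le b hK (r := 1) (by positivity) _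
      fun i j => ?_).trans (by nlinarith [sq_nonneg K]))
    rw [abs_of_pos (Real.exp_pos _), Real.exp_le_one_iff]
    have : 0 ≤ c * ‖B (η i - η j)‖ ^ 2 := by positivity
    linarith

/-- Split at `s = τ`, where the minimum switches. Near `0` integrability needs `ν > 0`. The tail `s
^ (ν - 1 - (N + 1))` converges because `ν ≤ N`, and its denominator `N + 1 - ν ≥ 1` keeps the bound
independent of `N`. -/
theorem integral_rpow_mul_min_le {ν τ : ℝ} {N : ℕ} (hν : 0 < ν) (hN : ν ≤ N) (hτ : 0 < τ) :
    IntegrableOn (fun s : ℝ => s ^ (ν - 1) * min 1 ((τ / s) ^ (N + 1))) (Ioi 0) ∧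
    ∫ s in Ioi (0 : ℝ), s ^ (ν - 1) * min 1 ((τ / s) ^ (N + 1)) ≤ τ ^ ν * (1 / ν + 1) := by
  set F : ℝ → ℝ := fun s => s ^ (ν - 1) * min 1 ((τ / s) ^ (N + 1)) with hF
  have hexp : ν - 1 - (N + 1 : ℝ) < -1 := by linarith
  have h1 : EqOn F (fun s => s ^ (ν - 1)) (Ioc 0 τ) := by
    intro s hs
    have : 1 ≤ (τ / s) ^ (N + 1) := one_le_pow₀ ((one_le_div hs.1).2 hs.2)
    simp [hF, min_eq_left this]
  have h2 : EqOn F (fun s => τ ^ (N + 1) * s ^ (ν - 1 - (N + 1 : ℝ))) (Ioi τ) := by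
    intro s hs
    have hs' : τ < s := hs
    have hs0 : 0 < s := hτ.trans hs'
    have : (τ / s) ^ (N + 1) ≤ 1 := pow_le_one₀ (by positivity) ((div_le_one hs0).2 hs'.le)
    simp only [hF, min_eq_right this]
    rw [Real.rpow_sub hs0 (ν - 1), div_pow]
    have : s ^ ((N : ℝ) + 1) = s ^ (N + 1) := by exact_mod_cast Real.rpow_natCast s (N + 1)
    rw [this]
    ring
  have i1 : IntegrableOn F (Ioc 0 τ) := by
    refine IntegrableOn.congr_fun ?_ h1.symm measurableSet_Ioc
    rw [← intervalIntegrable_iff_integrableOn_Ioc_of_le hτ.le]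
    exact intervalIntegral.intervalIntegrable_rpow' (by linarith)
  have i2 : IntegrableOn F (Ioi τ) := by
    refine IntegrableOn.congr_fun ?_ h2.symm measurableSet_Ioi
    exact (integrableOn_Ioi_rpow_of_lt hexp hτ).const_mul _
  have hU : Ioi (0 : ℝ) = Ioc 0 τ ∪ Ioi τ := (Ioc_union_Ioi_eq_Ioi hτ.le).symm
  have v1 : ∫ s in Ioc 0 τ, F s = τ ^ ν / ν := by
    rw [setIntegral_congr_fun measurableSet_Ioc h1, ← intervalIntegral.integral_of_le hτ.le,
      integral_rpow (Or.inl (by linarith))]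
    simp [hν.ne']
  have v2 : ∫ s in Ioi τ, F s ≤ τ ^ ν := by
    rw [setIntegral_congr_fun measurableSet_Ioi h2, integral_const_mul,
      integral_Ioi_rpow_of_lt hexp hτ]
    have e : ν - 1 - (N + 1 : ℝ) + 1 = ν - (N + 1 : ℝ) := by ring
    have e2 : τ ^ ((N : ℝ) + 1) = τ ^ (N + 1) := by exact_mod_cast Real.rpow_natCast τ (N + 1)
    rw [e, Real.rpow_sub hτ, e2]
    have e3 : τ ^ (N + 1) * (-(τ ^ ν / τ ^ (N + 1)) / (ν - (N + 1 : ℝ))) =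
        τ ^ ν / ((N : ℝ) + 1 - ν) := by
      have : (ν - (N + 1 : ℝ)) ≠ 0 := by linarith
      have : ((N : ℝ) + 1 - ν) ≠ 0 := by linarith
      field_simp
      ring
    rw [e3]
    exact div_le_self (by positivity) (by linarith)
  rw [hU]
  refine ⟨i1.union i2, ?_⟩
  rw [setIntegral_union (Ioc_disjoint_Ioi le_rfl) measurableSet_Ioi i1 i2, v1]
  calc _ ≤ τ ^ ν / ν + τ ^ ν := by gcongr
    _ = _ := by ring

/-- The Matérn quadratic form is small if the weights annihilate polynomials and the points are
close to each other. -/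
theorem maternKernel_sum_le_of_annihilates {k d N : ℕ} (p : MaternParams d) (hN : p.ν ≤ N)
    {J : Type*} [Fintype J] (b : J → ℝ) {K : ℝ} (hK : ∑ j, |b j| ≤ K)
    (η : J → EuclideanSpace ℝ (Fin k))
    (hb : ∀ q : MvPolynomial (Fin k) ℝ, q.totalDegree ≤ 2 * N →
      ∑ j, b j * MvPolynomial.eval (η j) q = 0)
    (T : EuclideanSpace ℝ (Fin k) →L[ℝ] EuclideanSpace ℝ (Fin d)) (x₀ : EuclideanSpace ℝ (Fin d))
    (y : J → EuclideanSpace ℝ (Fin d)) (hy : ∀ j, y j = x₀ + T (η j)) {r : ℝ} (hr : 0 < r)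
    (hyr : ∀ i j, ‖Matrix.toEuclideanCLM (n := Fin d) (𝕜 := ℝ) p.Θ⁻¹ (y i - y j)‖ ≤ r) :
    ∑ i, ∑ j, b i * b j * maternKernel p (y i) (y j) ≤
      2 * K ^ 2 * (1 / Real.Gamma p.ν * (1 / p.ν + 1) * (p.ν / 2) ^ p.ν) * (r ^ p.ν) ^ 2 := by
  have hν := p.ν_pos
  obtain ⟨hint, heq⟩ := maternKernel_sum_eq_integral p b y
  have hτ : 0 < p.ν / 2 * r ^ 2 := by positivity
  obtain ⟨hint2, hle⟩ := integral_rpow_mul_min_le (N := N) hν hN hτ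
  have hΓ := Real.Gamma_pos_of_pos hν
  rw [heq]
  have hmono : ∫ s in Ioi (0 : ℝ), (Real.exp (-s) * s ^ (p.ν - 1)) * ∑ i, ∑ j, b i * b j *
        Real.exp (-(p.ν / 2 / s * ‖Matrix.toEuclideanCLM (n := Fin d) (𝕜 := ℝ) p.Θ⁻¹
          (y i - y j)‖ ^ 2)) ≤
      ∫ s in Ioi (0 : ℝ), 2 * K ^ 2 * (s ^ (p.ν - 1) *
        min 1 ((p.ν / 2 * r ^ 2 / s) ^ (N + 1))) := by
    refine setIntegral_mono_on hint (hint2.const_mul _) measurableSet_Ioi fun s hs => ?_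
    have hs' : (0 : ℝ) < s := hs
    have h1 : 0 ≤ s ^ (p.ν - 1) := by positivity
    have hdiff : ∀ i j, y i - y j = T (η i - η j) := fun i j => by
      rw [hy, hy, map_sub]; abel
    have hG := gaussian_sum_le_of_annihilates b hK η hb
      ((Matrix.toEuclideanCLM (n := Fin d) (𝕜 := ℝ) p.Θ⁻¹).comp T) (c := p.ν / 2 / s)
      (x := p.ν / 2 * r ^ 2 / s) (by positivity) (fun i j => by
        rw [ContinuousLinearMap.comp_apply, ← hdiff]
        have h2 := pow_le_pow_left₀ (norm_nonneg _) (hyr i j) 2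
        calc _ ≤ p.ν / 2 / s * r ^ 2 := by gcongr
          _ = _ := by ring) (by positivity)
    simp only [ContinuousLinearMap.comp_apply, ← hdiff] at hG
    have hm : 0 ≤ min 1 ((p.ν / 2 * r ^ 2 / s) ^ (N + 1)) := by positivity
    calc _ ≤ (Real.exp (-s) * s ^ (p.ν - 1)) *
          (2 * K ^ 2 * min 1 ((p.ν / 2 * r ^ 2 / s) ^ (N + 1))) := by gcongr
      -- The decay of `exp (-s)` can be discarded, since the minimum already makes the tail
      -- integrable.
      _ ≤ (1 * s ^ (p.ν - 1)) * (2 * K ^ 2 * min 1 ((p.ν / 2 * r ^ 2 / s) ^ (N + 1))) := by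
          gcongr
          exact Real.exp_le_one_iff.2 (by linarith)
      _ = _ := by ring
  rw [integral_const_mul] at hmono
  have hpow : (p.ν / 2 * r ^ 2) ^ p.ν = (p.ν / 2) ^ p.ν * (r ^ p.ν) ^ 2 := by
    rw [Real.mul_rpow (by positivity) (by positivity), ← Real.rpow_natCast (r ^ p.ν),
      ← Real.rpow_natCast r, ← Real.rpow_mul hr.le, ← Real.rpow_mul hr.le, mul_comm p.ν]
  rw [hpow] at hle
  calc _ ≤ 1 / Real.Gamma p.ν * (2 * K ^ 2 *
        ((p.ν / 2) ^ p.ν * (r ^ p.ν) ^ 2 * (1 / p.ν + 1))) := by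
        refine mul_le_mul_of_nonneg_left (hmono.trans ?_) (by positivity)
        gcongr
    _ = _ := by ring

/-! ### Stable polynomial reproduction -/

/-- The matrix of the values of all monomials of partial degrees at most `m` at a family of points
with the same index set. -/
def monomialMatrix {k m : ℕ} (η : (Fin k → Fin (m + 1)) → EuclideanSpace ℝ (Fin k)) :
    Matrix (Fin k → Fin (m + 1)) (Fin k → Fin (m + 1)) ℝ :=
  Matrix.of fun β α => ∏ i, η α i ^ (β i : ℕ)

/-- A vector in the left kernel lists the coefficients of a polynomial of partial degrees at most
`m` that vanishes on a product grid with `m + 1` values per coordinate. Such a polynomial is zero.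
-/
theorem det_monomialMatrix_grid_ne_zero {k m : ℕ} {s : ℝ} (hs : s ≠ 0) :
    (monomialMatrix (k := k) (m := m)
      fun α => WithLp.toLp 2 fun i => s * ((α i : ℕ) : ℝ)).det ≠ 0 := by
  classical
  intro h0
  obtain ⟨w, hw, hMw⟩ := Matrix.exists_vecMul_eq_zero_iff.2 h0
  set e : (Fin k → Fin (m + 1)) → (Fin k →₀ ℕ) :=
    fun β => Finsupp.equivFunOnFinite.symm fun i => (β i : ℕ) with he
  have he_inj : Function.Injective e := by
    intro β γ h
    funext i
    exact Fin.ext (by simpa [he] using DFunLike.congr_fun h i)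
  set P : MvPolynomial (Fin k) ℝ := ∑ β, MvPolynomial.monomial (e β) (w β) with hP
  set S : Fin k → Finset ℝ := fun _ => Finset.univ.image fun j : Fin (m + 1) => s * ((j : ℕ) : ℝ)
    with hS
  have hcard : ∀ i, (S i).card = m + 1 := by
    intro i
    rw [hS]
    simp only
    rw [Finset.card_image_of_injective, Finset.card_univ, Fintype.card_fin]
    intro a b hab
    exact Fin.ext (by exact_mod_cast mul_left_cancel₀ hs hab)
  have hP0 : P = 0 := by
    refine MvPolynomial.eq_zero_of_eval_zero_at_prod_finset P S (fun i => ?_) fun x hx => ?_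
    · rw [hcard i, Nat.lt_succ_iff, hP]
      refine (MvPolynomial.degreeOf_sum_le i _ _).trans (Finset.sup_le fun β _ => ?_)
      by_cases hβ : w β = 0
      · simp [hβ]
      · rw [MvPolynomial.degreeOf_monomial_eq _ _ hβ]
        simpa [he] using Nat.lt_succ_iff.1 (β i).2
    · have hx' : ∀ i, ∃ j : Fin (m + 1), s * ((j : ℕ) : ℝ) = x i := fun i => by
        simpa [hS] using hx i
      choose α hα using hx'
      have h := congrFun hMw α
      simp only [Matrix.vecMul, dotProduct, monomialMatrix, Matrix.of_apply, Pi.zero_apply] at h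
      rw [← h, hP, map_sum]
      refine Finset.sum_congr rfl fun β _ => ?_
      rw [MvPolynomial.eval_monomial, Finsupp.prod_fintype _ _ (fun i => pow_zero _)]
      simp [he, hα]
  apply hw
  funext β
  have h := congrArg (MvPolynomial.coeff (e β)) hP0
  rw [hP, MvPolynomial.coeff_sum] at h
  simpa [MvPolynomial.coeff_monomial, he_inj.eq_iff] using h

theorem continuous_monomialMatrix {k m : ℕ} :
    Continuous (monomialMatrix (k := k) (m := m)) := by
  refine continuous_matrix fun β α => ?_
  simp only [monomialMatrix, Matrix.of_apply]
  fun_prop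

/-- Reproduction of a monomial basis implies reproduction of all polynomials of total degree at
most `m`. -/
theorem eval_eq_sum_of_reproduces_monomials {k m : ℕ} {J : Type*} [Fintype J] (a : J → ℝ)
    (η : J → EuclideanSpace ℝ (Fin k)) (v : EuclideanSpace ℝ (Fin k))
    (h : ∀ β : Fin k → Fin (m + 1), ∑ α, a α * ∏ i, η α i ^ (β i : ℕ) = ∏ i, v i ^ (β i : ℕ))
    (q : MvPolynomial (Fin k) ℝ) (hq : q.totalDegree ≤ m) :
    MvPolynomial.eval v q = ∑ α, a α * MvPolynomial.eval (η α) q := by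
  simp only [MvPolynomial.eval_eq', Finset.mul_sum]
  rw [Finset.sum_comm]
  refine Finset.sum_congr rfl fun e he => ?_
  have hle : ∀ i, e i < m + 1 := fun i => Nat.lt_succ_iff.2
    ((MvPolynomial.monomial_le_degreeOf i he).trans
      ((MvPolynomial.degreeOf_le_totalDegree q i).trans hq))
  have h1 := h fun i => ⟨e i, hle i⟩
  simp only at h1
  rw [← h1, Finset.mul_sum]
  exact Finset.sum_congr rfl fun α _ => by ring

/-- Polynomial reproduction with bounded weights, stable under perturbation of the nodes. -/
theorem exists_stable_polynomial_reproduction (k m : ℕ) {ρ : ℝ} (hρ : 0 < ρ) :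
    ∃ (g : (Fin k → Fin (m + 1)) → EuclideanSpace ℝ (Fin k)) (δ : ℝ), 0 < δ ∧
      (∀ α, ‖g α‖ ≤ ρ) ∧ ∀ R : ℝ, ∃ K : ℝ,
        ∀ η : (Fin k → Fin (m + 1)) → EuclideanSpace ℝ (Fin k), (∀ α, ‖η α - g α‖ ≤ δ) →
          ∀ v : EuclideanSpace ℝ (Fin k), ‖v‖ ≤ R → ∃ a : (Fin k → Fin (m + 1)) → ℝ,
            ∑ α, |a α| ≤ K ∧ ∀ q : MvPolynomial (Fin k) ℝ, q.totalDegree ≤ m →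
              MvPolynomial.eval v q = ∑ α, a α * MvPolynomial.eval (η α) q := by
  classical
  set g₁ : (Fin k → Fin (m + 1)) → EuclideanSpace ℝ (Fin k) :=
    fun α => WithLp.toLp 2 fun i => ((α i : ℕ) : ℝ) with hg₁
  -- The summand `1` keeps `c` positive even when all grid points are the origin (`k = 0` or `m =
  -- 0`).
  set c : ℝ := 1 + ∑ α, ‖g₁ α‖ with hc
  have hc0 : 0 < c := by positivity
  have hgc : ∀ α, ‖g₁ α‖ ≤ c := fun α =>
    (Finset.single_le_sum (f := fun α => ‖g₁ α‖) (fun _ _ => norm_nonneg _)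
      (Finset.mem_univ α)).trans (by rw [hc]; linarith)
  set s : ℝ := ρ / c with hs
  have hs0 : 0 < s := by positivity
  set g : (Fin k → Fin (m + 1)) → EuclideanSpace ℝ (Fin k) :=
    fun α => WithLp.toLp 2 fun i => s * ((α i : ℕ) : ℝ) with hg
  have hgs : ∀ α, g α = s • g₁ α := fun α => by ext i; simp [hg, hg₁]
  have hdet : (monomialMatrix g).det ≠ 0 := det_monomialMatrix_grid_ne_zero hs0.ne'
  have hev : ∀ᶠ η in 𝓝 g, (monomialMatrix η).det ≠ 0 :=
    (continuous_monomialMatrix.matrix_det.continuousAt).eventually_ne hdet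
  obtain ⟨δ, hδ, hball⟩ := Metric.nhds_basis_closedBall.eventually_iff.1 hev
  refine ⟨g, δ, hδ, fun α => ?_, fun R => ?_⟩
  · rw [hgs, norm_smul, Real.norm_of_nonneg hs0.le, hs, div_mul_eq_mul_div, div_le_iff₀ hc0]
    exact mul_le_mul_of_nonneg_left (hgc α) hρ.le
  · set φ : EuclideanSpace ℝ (Fin k) → (Fin k → Fin (m + 1)) → ℝ :=
      fun v β => ∏ i, v i ^ (β i : ℕ) with hφ
    have hφc : Continuous φ := by fun_prop
    -- The absolute sum of the weights is continuous in the nodes and in `v` wherever the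
    -- determinant is nonzero, so compactness of the product of balls yields `K`.
    set F : ((Fin k → Fin (m + 1)) → EuclideanSpace ℝ (Fin k)) × EuclideanSpace ℝ (Fin k) → ℝ :=
      fun x => ∑ α, |Matrix.mulVec (monomialMatrix x.1)⁻¹ (φ x.2) α| with hF
    have hFc : ContinuousOn F (Metric.closedBall g δ ×ˢ Metric.closedBall 0 R) := by
      intro x hx
      have hinv : ContinuousAt (fun x : ((Fin k → Fin (m + 1)) → EuclideanSpace ℝ (Fin k)) ×
          EuclideanSpace ℝ (Fin k) => (monomialMatrix x.1)⁻¹) x := by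
        refine ContinuousAt.comp (g := Inv.inv) (f := fun x : ((Fin k → Fin (m + 1)) →
          EuclideanSpace ℝ (Fin k)) × EuclideanSpace ℝ (Fin k) => monomialMatrix x.1) ?_
          (continuous_monomialMatrix.comp continuous_fst).continuousAt
        refine continuousAt_matrix_inv _ ?_
        rw [Ring.inverse_eq_inv']
        exact continuousAt_inv₀ (hball hx.1)
      have hφx := (hφc.comp continuous_snd).continuousAt (x := x)
      refine ContinuousAt.continuousWithinAt ?_
      refine tendsto_finsetSum _ fun α _ => ContinuousAt.abs ?_
      refine tendsto_finsetSum _ fun β _ => ?_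
      exact ((continuousAt_pi.1 (continuousAt_pi.1 hinv α)) β).mul (continuousAt_pi.1 hφx β)
    obtain ⟨K, hK⟩ := ((isCompact_closedBall g δ).prod
      (isCompact_closedBall (0 : EuclideanSpace ℝ (Fin k)) R)).exists_bound_of_continuousOn hFc
    refine ⟨K, fun η hη v hv => ⟨Matrix.mulVec (monomialMatrix η)⁻¹ (φ v), ?_, fun q hq => ?_⟩⟩
    · refine (le_abs_self _).trans (hK (η, v) ⟨?_, by simpa using hv⟩)
      rw [Metric.mem_closedBall, dist_pi_le_iff hδ.le]
      exact fun α => by rw [dist_eq_norm]; exact hη α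
    · refine eval_eq_sum_of_reproduces_monomials _ η v (fun β => ?_) q hq
      have hmem : η ∈ Metric.closedBall g δ := by
        rw [Metric.mem_closedBall, dist_pi_le_iff hδ.le]
        exact fun α => by rw [dist_eq_norm]; exact hη α
      have h1 : Matrix.mulVec (monomialMatrix η) (Matrix.mulVec (monomialMatrix η)⁻¹ (φ v)) =
          φ v := by
        rw [Matrix.mulVec_mulVec, Matrix.mul_nonsing_inv _ (isUnit_iff_ne_zero.2 (hball hmem)),
          Matrix.one_mulVec]
      have h2 := congrFun h1 β
      rw [Matrix.mulVec, dotProduct] at h2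
      simpa only [monomialMatrix, Matrix.of_apply, mul_comm] using h2

/-! ### Convex geometry and local reproduction -/

/-- A nonempty bounded convex set is, up to an isometric embedding and a translation, a bounded
set which contains a ball around the origin. -/
theorem Convex.exists_isometric_coordinates {d : ℕ} {Ω : Set (EuclideanSpace ℝ (Fin d))}
    (hΩb : Bornology.IsBounded Ω) (hΩc : Convex ℝ Ω) (hne : Ω.Nonempty) :
    ∃ (k : ℕ) (T : EuclideanSpace ℝ (Fin k) →ₗᵢ[ℝ] EuclideanSpace ℝ (Fin d))
      (z : EuclideanSpace ℝ (Fin d)) (ρ R : ℝ), 0 < ρ ∧ 0 < R ∧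
      (∀ v, ‖v‖ ≤ ρ → z + T v ∈ Ω) ∧ ∀ x ∈ Ω, ∃ v, ‖v‖ ≤ R ∧ x = z + T v := by
  -- The relative interior is used because `Ω` may have empty interior; `k` is the dimension of its
  -- affine span.
  obtain ⟨z, hz⟩ := hne.intrinsicInterior hΩc
  have hzΩ : z ∈ Ω := intrinsicInterior_subset hz
  obtain ⟨z', hz', rfl⟩ := mem_intrinsicInterior.1 hz
  obtain ⟨ρ, hρ, hball⟩ := Metric.nhds_basis_closedBall.mem_iff.1 (mem_interior_iff_mem_nhds.1 hz')
  set V := (affineSpan ℝ Ω).direction with hV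
  set E := stdOrthonormalBasis ℝ V with hE
  set T : EuclideanSpace ℝ (Fin (Module.finrank ℝ V)) →ₗᵢ[ℝ] EuclideanSpace ℝ (Fin d) :=
    V.subtypeₗᵢ.comp E.repr.symm.toLinearIsometry with hT
  obtain ⟨R, hR, hΩR⟩ := hΩb.exists_pos_norm_le
  refine ⟨_, T, z', ρ, 2 * R, hρ, by positivity, fun v hv => ?_, fun x hx => ?_⟩
  · have hTv : T v ∈ V := (E.repr.symm v).2
    have hmem : (z' : EuclideanSpace ℝ (Fin d)) + T v ∈ affineSpan ℝ Ω := by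
      rw [add_comm]
      exact AffineSubspace.vadd_mem_of_mem_direction hTv z'.2
    have h : (⟨_, hmem⟩ : affineSpan ℝ Ω) ∈ Metric.closedBall z' ρ := by
      rw [Metric.mem_closedBall, Subtype.dist_eq, dist_eq_norm]
      simpa using hv
    exact hball h
  · have hmem : x - z' ∈ V :=
      AffineSubspace.vsub_mem_direction (subset_affineSpan ℝ Ω hx) z'.2
    have hTv : T (E.repr ⟨x - z', hmem⟩) = x - z' := by simp [hT]
    refine ⟨E.repr ⟨x - z', hmem⟩, ?_, by rw [hTv]; abel⟩
    rw [← T.norm_map, hTv]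
    linarith [norm_sub_le x z', hΩR x hx, hΩR _ hzΩ]

/-- Boundedness of `Ω` matters: an unbounded real supremum would take the default value `0`. The
minimum is attained as `X` is finite. -/
theorem norm_sub_le_fillDistance {d : ℕ} {Ω : Set (EuclideanSpace ℝ (Fin d))}
    (hΩb : Bornology.IsBounded Ω) {X : Finset Ω} (hX : X.Nonempty) (x : Ω) :
    ∃ u ∈ X, ‖(x : EuclideanSpace ℝ (Fin d)) - u‖ ≤ fillDistance X := by
  have : Nonempty X := hX.to_subtype
  obtain ⟨R, hR, hΩR⟩ := hΩb.exists_pos_norm_le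
  obtain ⟨u, hu⟩ := exists_eq_ciInf_of_finite
    (f := fun u : X => ‖(x : EuclideanSpace ℝ (Fin d)) - (u : Ω)‖)
  refine ⟨u, u.2, ?_⟩
  rw [hu]
  refine le_ciSup (f := fun x : Ω => ⨅ u : X, ‖(x : EuclideanSpace ℝ (Fin d)) - (u : Ω)‖)
    ⟨2 * R, ?_⟩ x
  rintro _ ⟨y, rfl⟩
  refine (ciInf_le ⟨0, ?_⟩ u).trans ?_
  · rintro _ ⟨v, rfl⟩
    exact norm_nonneg _
  · linarith [norm_sub_le (y : EuclideanSpace ℝ (Fin d)) (u : Ω), hΩR y y.2, hΩR _ (u : Ω).2]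

theorem fillDistance_nonneg {d : ℕ} {Ω : Set (EuclideanSpace ℝ (Fin d))} (X : Finset Ω) :
    0 ≤ fillDistance X :=
  Real.iSup_nonneg fun _ => Real.iInf_nonneg fun _ => norm_nonneg _

/-- In a bounded convex set, every point has weights on nearby points of a sufficiently dense
design which reproduce polynomials. -/
theorem Convex.exists_local_polynomial_reproduction {d : ℕ}
    {Ω : Set (EuclideanSpace ℝ (Fin d))} (hΩb : Bornology.IsBounded Ω) (hΩc : Convex ℝ Ω)
    (hne : Ω.Nonempty) (m : ℕ) :
    ∃ (k : ℕ) (T : EuclideanSpace ℝ (Fin k) →ₗᵢ[ℝ] EuclideanSpace ℝ (Fin d)) (δ D K : ℝ),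
      0 < δ ∧ 0 < D ∧ ∀ (X : Finset Ω), X.Nonempty → ∀ (x : Ω) (t : ℝ), 0 < t → t ≤ 1 →
        fillDistance X ≤ δ * t → ∃ (x₀ : EuclideanSpace ℝ (Fin d))
          (y : (Fin k → Fin (m + 1)) → Ω) (a : (Fin k → Fin (m + 1)) → ℝ)
          (η : (Fin k → Fin (m + 1)) → EuclideanSpace ℝ (Fin k)) (v : EuclideanSpace ℝ (Fin k)),
          (∀ α, y α ∈ X) ∧ (∀ α, (y α : EuclideanSpace ℝ (Fin d)) = x₀ + t • T (η α)) ∧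
          (x : EuclideanSpace ℝ (Fin d)) = x₀ + t • T v ∧ (∀ α, ‖η α‖ ≤ D) ∧ ‖v‖ ≤ D ∧
          ∑ α, |a α| ≤ K ∧ ∀ q : MvPolynomial (Fin k) ℝ, q.totalDegree ≤ m →
            MvPolynomial.eval v q = ∑ α, a α * MvPolynomial.eval (η α) q := by
  obtain ⟨k, T, z, ρ, R, hρ, hR, hball, hcoord⟩ := hΩc.exists_isometric_coordinates hΩb hne
  obtain ⟨g, δ, hδ, hg, hrep⟩ := exists_stable_polynomial_reproduction k m hρ
  obtain ⟨K, hK⟩ := hrep R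
  refine ⟨k, T, δ, ρ + δ + R, K, hδ, by positivity, fun X hX x t ht ht1 hfill => ?_⟩
  obtain ⟨v, hv, hxv⟩ := hcoord x x.2
  -- Shrinking `Ω` towards `x` by the factor `t` stays inside `Ω` by convexity, and carries the
  -- reference grid to points near `x`.
  have hmem : ∀ α, (x : EuclideanSpace ℝ (Fin d)) + t • (z + T (g α) - x) ∈ Ω := fun α =>
    hΩc.add_smul_sub_mem x.2 (hball _ (hg α)) ⟨ht.le, ht1⟩
  choose y hyX hy using fun α => norm_sub_le_fillDistance hΩb hX ⟨_, hmem α⟩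
  choose w hwR hw using fun α => hcoord (y α) (y α).2
  -- Coordinates dilated by `t⁻¹` about `v`: the point `x` keeps the coordinate `v`, the shrunken
  -- grid point becomes `g α`, and a distance of at most `δ * t` becomes at most `δ`.
  set η : (Fin k → Fin (m + 1)) → EuclideanSpace ℝ (Fin k) := fun α => t⁻¹ • (w α - v) + v with hη
  have hyη : ∀ α, (y α : EuclideanSpace ℝ (Fin d)) = x - t • T v + t • T (η α) := by
    intro α
    rw [hw α, hη, hxv]
    simp only [map_add, map_smul, map_sub, smul_add, smul_smul, mul_inv_cancel₀ ht.ne', one_smul]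
    abel
  have hclose : ∀ α, ‖η α - g α‖ ≤ δ := by
    intro α
    have h1 : (x : EuclideanSpace ℝ (Fin d)) + t • (z + T (g α) - x) - y α =
        t • T (g α - η α) := by
      rw [hyη α, hxv, map_sub]
      module
    have h2 := (hy α).trans hfill
    simp only [h1, norm_smul, Real.norm_of_nonneg ht.le, T.norm_map] at h2
    rw [norm_sub_rev]
    exact le_of_mul_le_mul_left (by linarith) ht
  obtain ⟨a, ha, hq⟩ := hK η hclose v hv
  refine ⟨x - t • T v, y, a, η, v, hyX, hyη, by abel, fun α => ?_, by linarith, ha, hq⟩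
  have h1 : ‖η α‖ ≤ ‖η α - g α‖ + ‖g α‖ := by
    simpa using norm_add_le (η α - g α) (g α)
  linarith [hclose α, hg α]

/-! ### Uniform constants and the final estimate -/

theorem ContinuousOn.exists_pos_le_of_Icc {a b : ℝ} {f : ℝ → ℝ} (hf : ContinuousOn f (Icc a b)) :
    ∃ M, 0 < M ∧ ∀ ν, a ≤ ν → ν ≤ b → f ν ≤ M := by
  obtain ⟨M, hM⟩ := isCompact_Icc.exists_bound_of_continuousOn hf
  exact ⟨max M 1, by positivity, fun ν h1 h2 =>
    (le_abs_self _).trans ((hM ν ⟨h1, h2⟩).trans (le_max_left _ _))⟩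

theorem continuousOn_maternConstant {a b : ℝ} (ha : 0 < a) :
    ContinuousOn (fun ν : ℝ => 1 / Real.Gamma ν * (1 / ν + 1) * (ν / 2) ^ ν) (Icc a b) := by
  intro ν hν
  have hν0 : 0 < ν := ha.trans_le hν.1
  refine ContinuousAt.continuousWithinAt ?_
  have hΓ : ContinuousAt Real.Gamma ν :=
    (Real.differentiableAt_Gamma fun m => by
      have : (0 : ℝ) ≤ m := m.cast_nonneg
      linarith).continuousAt
  have h1 : ContinuousAt (fun ν : ℝ => (ν / 2) ^ ν) ν :=
    (continuousAt_id.div_const 2).rpow continuousAt_id (Or.inl (by simpa using hν0.ne'))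
  exact ((continuousAt_const.div hΓ (Real.Gamma_pos_of_pos hν0).ne').mul
    ((continuousAt_const.div continuousAt_id hν0.ne').add continuousAt_const)).mul h1

theorem norm_toEuclideanCLM_apply_le {d : ℕ} (A : Matrix (Fin d) (Fin d) ℝ)
    (x : EuclideanSpace ℝ (Fin d)) :
    ‖Matrix.toEuclideanCLM (n := Fin d) (𝕜 := ℝ) A x‖ ≤ specNorm A * ‖x‖ :=
  ContinuousLinearMap.le_opNorm _ _

/-- The uniform pointwise error estimate for Matérn interpolation on a bounded convex set. -/
theorem exists_kernelInterpolant_error_bound {d : ℕ} {Ω : Set (EuclideanSpace ℝ (Fin d))}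
    (hΩb : Bornology.IsBounded Ω) (hΩc : Convex ℝ Ω) {C νmin νmax : ℝ} (hC : 0 < C)
    (hνmin : 0 < νmin) :
    ∃ c : ℝ, 0 < c ∧ ∀ (p : MaternParams d) (X : Finset Ω) (z : Ω → ℝ), X.Nonempty →
      C ≤ specNorm p.Θ⁻¹ → νmin ≤ p.ν → p.ν ≤ νmax → z ∈ nativeSpace p Ω → ∀ x : Ω,
        |z x - kernelInterpolant p X z x| ≤
          c * (specNorm p.Θ⁻¹ ^ p.ν * fillDistance X ^ p.ν * nativeNorm p Ω z) := by
  rcases Ω.eq_empty_or_nonempty with rfl | hne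
  · exact ⟨1, one_pos, fun _ _ _ _ _ _ _ _ x => absurd x.2 (notMem_empty _)⟩
  -- One degree `2 * N` serves all `ν ≤ νmax`, so `δ`, `D` and `K` do not depend on the kernel.
  set N : ℕ := ⌈νmax⌉₊ with hN
  obtain ⟨k, T, δ, D, K, hδ, hD, hrep⟩ :=
    hΩc.exists_local_polynomial_reproduction hΩb hne (2 * N)
  obtain ⟨M₁, hM₁, hM₁'⟩ := (continuousOn_maternConstant (b := νmax) hνmin).exists_pos_le_of_Icc
  have hrpow : ∀ a : ℝ, 0 < a → ContinuousOn (fun ν : ℝ => a ^ ν) (Icc νmin νmax) := fun a ha =>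
    (Real.continuous_const_rpow ha.ne').continuousOn
  obtain ⟨M₂, hM₂, hM₂'⟩ := (hrpow (2 * D / δ) (by positivity)).exists_pos_le_of_Icc
  obtain ⟨M₃, hM₃, hM₃'⟩ := (hrpow (C * δ)⁻¹ (by positivity)).exists_pos_le_of_Icc
  set c₁ : ℝ := √(2 * (1 + K) ^ 2 * M₁) * M₂ with hc₁
  have hc₁0 : 0 ≤ c₁ := by positivity
  -- `c₁` serves designs with `0 < h ≤ δ`, and `M₃` those with `h > δ`.
  refine ⟨c₁ + M₃, by positivity, fun p X z hX hCp hν1 hν2 hz x => ?_⟩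
  have hν := p.ν_pos
  have hh := fillDistance_nonneg X
  set lam := specNorm p.Θ⁻¹ with hlam
  set h := fillDistance X with hh_def
  have hlam0 : 0 < lam := hC.trans_le hCp
  have hA : 0 ≤ lam ^ p.ν * h ^ p.ν := by positivity
  suffices H : ∃ (J : Type) (_ : Fintype J) (a : J → ℝ) (y : J → Ω), (∀ j, y j ∈ X) ∧
      ∑ i : Option J, ∑ j : Option J, i.elim 1 a * j.elim 1 a *
        maternKernel p ((i.elim x y : Ω) : EuclideanSpace ℝ (Fin d)) (j.elim x y : Ω) ≤
        ((c₁ + M₃) * (lam ^ p.ν * h ^ p.ν)) ^ 2 by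
    obtain ⟨J, _, a, y, hy, hq⟩ := H
    exact (abs_sub_kernelInterpolant_le p X z hz x a y hy hq (by positivity)).trans_eq (by ring)
  -- If `h = 0` the scale `h / δ` degenerates, but then `x` lies in the design and the weight `-1`
  -- at `x` itself makes the form zero.
  rcases hh.eq_or_lt with hh0 | hh0
  · obtain ⟨u, hu, hxu⟩ := norm_sub_le_fillDistance hΩb hX x
    rw [← hh_def, ← hh0] at hxu
    have hxu' : x = u := Subtype.ext (sub_eq_zero.1 (norm_le_zero_iff.1 hxu))
    refine ⟨Unit, inferInstance, fun _ => -1, fun _ => x, fun _ => hxu' ▸ hu, ?_⟩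
    refine le_trans (le_of_eq ?_) (sq_nonneg _)
    simp [Fintype.sum_option]
  rcases le_or_gt h δ with hhδ | hhδ
  · obtain ⟨x₀, y, a, η, v, hyX, hy, hx, hη, hv, ha, hq⟩ := hrep X hX x (h / δ) (by positivity)
      ((div_le_one hδ).2 hhδ) (by rw [mul_div_cancel₀ _ hδ.ne'])
    refine ⟨Fin k → Fin (2 * N + 1), inferInstance, fun α => -a α, y, hyX, ?_⟩
    set t := h / δ with ht
    have ht0 : 0 < t := by positivity
    set b : Option (Fin k → Fin (2 * N + 1)) → ℝ := fun i => i.elim 1 fun α => -a α with hb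
    set ζ : Option (Fin k → Fin (2 * N + 1)) → EuclideanSpace ℝ (Fin k) :=
      fun i => i.elim v η with hζ
    set Y : Option (Fin k → Fin (2 * N + 1)) → EuclideanSpace ℝ (Fin d) :=
      fun i => ((i.elim x y : Ω) : EuclideanSpace ℝ (Fin d)) with hY
    have hYζ : ∀ i, Y i = x₀ + (t • T.toContinuousLinearMap) (ζ i) := by
      rintro (_ | α)
      · simpa [hY, hζ] using hx
      · simpa [hY, hζ] using hy α
    have hζD : ∀ i, ‖ζ i‖ ≤ D := by
      rintro (_ | α)
      · exact hv
      · exact hη α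
    have hr : 0 < lam * h * (2 * D / δ) := by positivity
    have hYr : ∀ i j, ‖Matrix.toEuclideanCLM (n := Fin d) (𝕜 := ℝ) p.Θ⁻¹ (Y i - Y j)‖ ≤
        lam * h * (2 * D / δ) := by
      intro i j
      refine (norm_toEuclideanCLM_apply_le _ _).trans ?_
      have h1 : Y i - Y j = t • T (ζ i - ζ j) := by
        rw [hYζ, hYζ, map_sub]
        simp [smul_sub]
      have h2 : ‖ζ i - ζ j‖ ≤ 2 * D := by
        linarith [norm_sub_le (ζ i) (ζ j), hζD i, hζD j]
      rw [h1, norm_smul, T.norm_map, Real.norm_of_nonneg ht0.le]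
      calc lam * (t * ‖ζ i - ζ j‖) ≤ lam * (t * (2 * D)) := by gcongr
        _ = _ := by rw [ht]; ring
    have hsum : ∑ i, |b i| ≤ 1 + K := by
      rw [Fintype.sum_option]
      simpa [hb] using ha
    have hann : ∀ q : MvPolynomial (Fin k) ℝ, q.totalDegree ≤ 2 * N →
        ∑ i, b i * MvPolynomial.eval (ζ i) q = 0 := by
      intro q hqd
      rw [Fintype.sum_option]
      simp [hb, hζ, hq q hqd]
    have hmain := maternKernel_sum_le_of_annihilates p (hν2.trans (Nat.le_ceil νmax)) b hsum ζ hann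
      (t • T.toContinuousLinearMap) x₀ Y hYζ hr hYr
    refine hmain.trans ?_
    have e1 : (lam * h * (2 * D / δ)) ^ p.ν ≤ lam ^ p.ν * h ^ p.ν * M₂ := by
      rw [Real.mul_rpow (by positivity) (by positivity), Real.mul_rpow hlam0.le hh]
      exact mul_le_mul_of_nonneg_left (hM₂' _ hν1 hν2) hA
    have e2 := hM₁' _ hν1 hν2
    calc _ ≤ 2 * (1 + K) ^ 2 * M₁ * (lam ^ p.ν * h ^ p.ν * M₂) ^ 2 := by gcongr
      _ = (c₁ * (lam ^ p.ν * h ^ p.ν)) ^ 2 := by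
        rw [hc₁, mul_pow _ (lam ^ p.ν * h ^ p.ν) 2, mul_pow (√_) M₂, Real.sq_sqrt (by positivity)]
        ring
      _ ≤ _ := by gcongr; linarith
  -- For a coarse design no nodes are used: the form is `Φ(x, x) = 1`, and `lam * h ≥ C * δ` makes
  -- the right-hand side at least `1`.
  · refine ⟨Empty, inferInstance, fun j => j.elim, fun j => j.elim, fun j => j.elim, ?_⟩
    have e1 : 1 ≤ M₃ * (lam ^ p.ν * h ^ p.ν) := by
      have e2 : (C * δ) ^ p.ν ≤ lam ^ p.ν * h ^ p.ν := by
        rw [← Real.mul_rpow hlam0.le hh]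
        gcongr
      have e3 := hM₃' _ hν1 hν2
      rw [Real.inv_rpow (by positivity)] at e3
      have e4 : 0 < (C * δ) ^ p.ν := by positivity
      calc (1 : ℝ) = ((C * δ) ^ p.ν)⁻¹ * (C * δ) ^ p.ν := (inv_mul_cancel₀ e4.ne').symm
        _ ≤ _ := by gcongr
    have e5 : 1 ≤ (c₁ + M₃) * (lam ^ p.ν * h ^ p.ν) := by nlinarith
    calc _ = (1 : ℝ) := by
          simp only [Fintype.sum_option, Finset.univ_eq_empty, Finset.sum_empty, add_zero,
            Option.elim, one_mul, maternKernel_self]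
      _ ≤ _ := one_le_pow₀ e5

theorem proposition1 {d : ℕ} (Ω : Set (EuclideanSpace ℝ (Fin d)))
    (hΩb : Bornology.IsBounded Ω) (hΩc : Convex ℝ Ω)
    (C₁ C₂ C₃ C₄ νmin νmax : ℝ) (hC₁ : 0 < C₁) (hC₂ : 0 < C₂) (hC₃ : 0 < C₃) (hC₄ : 0 < C₄)
    (hνmin : 0 < νmin) (hνmax : 0 < νmax) :
    ∃ c₀ : ℝ, 0 < c₀ ∧
      ∀ (L : ℕ) (p : ℕ → MaternParams d) (X : ℕ → Finset Ω) (f : ℕ → Ω → ℝ),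
        f 0 = 0 →
        (∀ l ∈ Finset.Icc 1 L, (X l).Nonempty) →
        (∀ l ∈ Finset.Icc 1 L, ∀ m ∈ Finset.Icc 1 L, l ≤ m → X m ⊆ X l) →
        (∀ l ∈ Finset.Icc 1 L, C₁ ≤ specNorm (p l).Θ⁻¹ ∧ specNorm (p l).Θ⁻¹ ≤ C₂) →
        (∀ l ∈ Finset.Icc 1 L, C₃ ≤ specNorm (p l).Θ ∧ specNorm (p l).Θ ≤ C₄) →
        (∀ l ∈ Finset.Icc 1 L, νmin ≤ (p l).ν ∧ (p l).ν ≤ νmax) →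
        (∀ l ∈ Finset.Icc 1 L, f l - f (l - 1) ∈ nativeSpace (p l) Ω) →
        ∀ x : Ω,
          |f L x - multilevelInterpolator L p X f x| ≤
            c₀ * ∑ l ∈ Finset.Icc 1 L,
              specNorm (p l).Θ⁻¹ ^ (p l).ν * fillDistance (X l) ^ (p l).ν *
                nativeNorm (p l) Ω (f l - f (l - 1)) := by
  obtain ⟨c, hc, hcb⟩ := exists_kernelInterpolant_error_bound hΩb hΩc (νmax := νmax) hC₁ hνmin
  refine ⟨c, hc, fun L p X f hf0 hX _ hΘinv _ hν hf x => ?_⟩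
  rw [Finset.mul_sum]
  exact multilevelInterpolator_error_le L p X f hf0 x _ fun l hl =>
    hcb (p l) (X l) _ (hX l hl) (hΘinv l hl).1 (hν l hl).1 (hν l hl).2 (hf l hl) x
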